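/- Let $n\in\mathbb N=\{1,2,\dots\}$, let $A$ be a real $n\times n$ matrix that is diagonalizable over $\mathbb R$ with positive eigenvalues, and let $G:\mathbb R^n\to\mathbb R^n$ be locally Lipschitz. Suppose there are $G_m:\mathbb R^n\to\mathbb R^n$, $m\ge 2$, each a homogeneous polynomial of degree $m$, such that for every $N\ge 2$ there is $\delta>0$ with $|G(x)-\sum_{m=2}^N G_m(x)|=\mathcal O(|x|^{N+\delta})$ as $x\to 0$. Each $G_m$ can be written as $G_m(x)=\mathcal G_m(x,\dots,x)$ with an $m$-linear map $\mathcal G_m$; fix any such $\mathcal G_m$. Let $f:(0,\infty)\to\mathbb R^n$ be continuous on $[T_f,\infty)$ for some $T_f\ge 0$, and let $y\in C^1((T_0,\infty),\mathbb R^n)$, for some $T_0\ge 0$, solve $$y'=-Ay+G(y)+f(t)\quad\text{on }(T_0,\infty),\qquad y(t)\to 0\text{ as }t\to\infty .$$ Let $(\mu_k)_{k\ge 1}$ and $(\beta_j)_{j\ge 1}$ be divergent, strictly increasing sequences of real numbers with $\mu_1>0$ and $\beta_1\ge 0$, such that each of the sets $\{\mu_k\}$ and $\{\beta_j\}$ is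 closed under addition and under $x\mapsto x+1$. For polynomials $g_{k,j}:\mathbb R\to\mathbb R^n$ such that for each $k$ only finitely many $g_{k,j}$ are nonzero, write $$g(t)\sim\sum_{k=1}^\infty \frac1{t^{\mu_k}}\Big(\sum_{j=1}^\infty \frac{g_{k,j}(\ln\ln t)}{(\ln t)^{\beta_j}}\Big)$$ if for every $N\ge 1$ there is $\nu>\mu_N$ such that $\big|g(t)-\sum_{k=1}^N t^{-\mu_k}\sum_{j} g_{k,j}(\ln\ln t)(\ln t)^{-\beta_j}\big|=\mathcal O(t^{-\nu})$ as $t\to\infty$. Suppose $$f(t)\sim\sum_{k=1}^\infty \frac1{t^{\mu_k}}\Big(\sum_{j=1}^\infty \frac{p_{k,j}(\ln\ln t)}{(\ln t)^{\beta_j}}\Big),$$ where the $p_{k,j}:\mathbb R\to\mathbb R^n$ are polynomials and, for each $k$, only finitely many $p_{k,j}$ are nonzero. Then $$y(t)\sim\sum_{k=1}^\infty \frac1{t^{\mu_k}}\Big(\sum_{j=1}^\infty \frac{q_{k,j}(\ln\ln t)}{(\ln t)^{\beta_j}}\Big),$$ where the $q_{k,j}:\mathbb R\to\mathbb R^n$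 are polynomials, for each $k$ only finitely many of them nonzero, given by $q_{1,j}=A^{-1}p_{1,j}$ for $j\ge 1$ and, for $k\ge 2$, $j\ge 1$, $$q_{k,j}=A^{-1}\Big\{\sum_{m\ge 2}\ \sum_{\substack{\mu_{j_1}+\dots+\mu_{j_m}=\mu_k\\ \beta_{l_1}+\dots+\beta_{l_m}=\beta_j}}\mathcal G_m(q_{j_1,l_1},\dots,q_{j_m,l_m})+p_{k,j}+\chi_{k,j}\Big\}$$ (a finite sum, over all indices $j_i,l_i\ge 1$). Here $\chi_{k,j}=0$ if there is no $\lambda\ge 1$ with $\mu_\lambda+1=\mu_k$. If there is such a $\lambda$ (it is then unique), then $$\chi_{k,j}=\begin{cases}\mu_\lambda q_{\lambda,j}-q_{\lambda,\ell}'+\beta_\ell q_{\lambda,\ell},&\text{if there is (a unique) }\ell\ge 1\text{ with }\beta_\ell+1=\beta_j,\\ \mu_\lambda q_{\lambda,j},&\text{if there is no such }\ell.\end{cases}$$ -/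

import Mathlib

open Filter Topology Asymptotics

/-- The real matrix `A` is diagonalizable (over the reals) and its eigenvalues are positive. -/
def IsDiagonalizablePos {n : ℕ} (A : Matrix (Fin n) (Fin n) ℝ) : Prop :=
  ∃ (S : Matrix (Fin n) (Fin n) ℝ) (Λ : Fin n → ℝ),
    IsUnit S ∧ (∀ i, 0 < Λ i) ∧ A = S⁻¹ * Matrix.diagonal Λ * S

/-- `g : ℝⁿ → ℝⁿ` is a homogeneous polynomial of degree `m` (the zero map is allowed). -/
def IsHomogeneousPolynomialMap {n : ℕ} (m : ℕ)
    (g : EuclideanSpace ℝ (Fin n) → EuclideanSpace ℝ (Fin n)) : Prop :=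
  ∀ i : Fin n, ∃ P : MvPolynomial (Fin n) ℝ, P.IsHomogeneous m ∧
    ∀ v : EuclideanSpace ℝ (Fin n), g v i = MvPolynomial.eval (fun l => v l) P

/-- `G(v) ∼ ∑_{m ≥ 2} Gm(v)` as `v → 0`: for every `N ≥ 2` there is `δ > 0` with
`|G(v) - ∑_{m=2}^N Gm(v)| = O(|v|^(N+δ))` as `v → 0`. -/
def HasHomogeneousExpansion {n : ℕ}
    (G : EuclideanSpace ℝ (Fin n) → EuclideanSpace ℝ (Fin n))
    (Gm : ℕ → EuclideanSpace ℝ (Fin n) → EuclideanSpace ℝ (Fin n)) : Prop :=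
  ∀ N : ℕ, 2 ≤ N → ∃ δ : ℝ, 0 < δ ∧
    (fun v => G v - ∑ m ∈ Finset.Icc 2 N, Gm m v) =O[𝓝 0] (fun v => ‖v‖ ^ ((N : ℝ) + δ))

/-- `p : ℝ → X` is a polynomial with coefficients in the real vector space `X`. -/
def IsVectorPolynomial {X : Type*} [AddCommGroup X] [Module ℝ X] (p : ℝ → X) : Prop :=
  ∃ (N : ℕ) (a : ℕ → X), ∀ z : ℝ, p z = ∑ i ∈ Finset.range (N + 1), z ^ i • a i

/-- `S` preserves the addition. -/
def PreservesAddition (S : Set ℝ) : Prop := ∀ x ∈ S, ∀ y ∈ S, x + y ∈ S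

/-- `S` preserves the unit increment. -/
def PreservesUnitIncrement (S : Set ℝ) : Prop := ∀ x ∈ S, x + 1 ∈ S

/-- `∑_j p_{k,j}(ln ln t) (ln t)^{-β_j}`; used only when, for each `k`, all but finitely many of
the `p_{k,j}` vanish. -/
noncomputable def logCoefficient {n : ℕ} (β : ℕ → ℝ)
    (p : ℕ → ℕ → ℝ → EuclideanSpace ℝ (Fin n)) (k : ℕ) (t : ℝ) : EuclideanSpace ℝ (Fin n) :=
  ∑ᶠ j : ℕ, (Real.log t ^ (-β j)) • p k j (Real.log (Real.log t))

/-- `g(t) ∼ ∑_k t^{-μ_k} ∑_j p_{k,j}(ln ln t) (ln t)^{-β_j}` as `t → ∞`: each partial sum up to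
the power `μ_N` approximates `g` up to `O(t^{-ν})` for some `ν > μ_N`.
Sequences are indexed from `0`. -/
def HasPowerLogLogExpansion {n : ℕ} (g : ℝ → EuclideanSpace ℝ (Fin n)) (μ β : ℕ → ℝ)
    (p : ℕ → ℕ → ℝ → EuclideanSpace ℝ (Fin n)) : Prop :=
  ∀ N : ℕ, ∃ ν : ℝ, μ N < ν ∧
    (fun t : ℝ => g t - ∑ k ∈ Finset.range (N + 1), (t ^ (-μ k)) • logCoefficient β p k t)
      =O[atTop] (fun t : ℝ => t ^ (-ν))

/-- The index set of the double sum for `(k, j)`: a length `m ≥ 2` together with indices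
`(j_1, l_1), …, (j_m, l_m)` such that `∑ μ_{j_i} = μ_k` and `∑ β_{l_i} = β_j`. -/
def resonantTuples (μ β : ℕ → ℝ) (k j : ℕ) : Set (Σ m : ℕ, Fin m → ℕ × ℕ) :=
  {s | 2 ≤ s.1 ∧ ∑ i, μ (s.2 i).1 = μ k ∧ ∑ i, β (s.2 i).2 = β j}

/-- The double sum is a finite sum. -/
theorem resonantTuples_finite {μ β : ℕ → ℝ} (hμ : StrictMono μ) (hμ0 : 0 < μ 0)
    (hβ : StrictMono β) (hβ0 : 0 ≤ β 0) (k j : ℕ) : (resonantTuples μ β k j).Finite := by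
  have hμp : ∀ i, μ 0 ≤ μ i := fun i => hμ.monotone (Nat.zero_le i)
  have hβp : ∀ i, 0 ≤ β i := fun i => hβ0.trans (hβ.monotone (Nat.zero_le i))
  obtain ⟨M, hM⟩ := exists_nat_gt (μ k / μ 0)
  have hfin : (⋃ m ∈ Finset.range (M + 1), Set.range
      (fun u : Fin m → Fin (k + 1) × Fin (j + 1) =>
        (⟨m, fun i => ((u i).1.val, (u i).2.val)⟩ : Σ m : ℕ, Fin m → ℕ × ℕ))).Finite :=
    Set.Finite.biUnion (Finset.finite_toSet _) fun m _ => Set.finite_range _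
  refine hfin.subset ?_
  rintro ⟨m, u⟩ ⟨-, h1, h2⟩
  simp only at h1 h2
  have hm : m < M + 1 := by
    have h3 : (m : ℝ) * μ 0 ≤ μ k := by
      rw [← h1]
      have := Finset.card_nsmul_le_sum (Finset.univ : Finset (Fin m)) (fun i => μ (u i).1) (μ 0)
        (fun i _ => hμp _)
      simpa using this
    have h4 : (m : ℝ) < M := ((le_div_iff₀ hμ0).2 h3).trans_lt hM
    have : m < M := by exact_mod_cast h4
    omega
  have hk : ∀ i, (u i).1 < k + 1 := fun i => by
    have : μ (u i).1 ≤ μ k := by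
      rw [← h1]
      exact Finset.single_le_sum (f := fun i => μ (u i).1)
        (fun i _ => hμ0.le.trans (hμp _)) (Finset.mem_univ i)
    exact Nat.lt_succ_of_le (hμ.le_iff_le.1 this)
  have hj : ∀ i, (u i).2 < j + 1 := fun i => by
    have : β (u i).2 ≤ β j := by
      rw [← h2]
      exact Finset.single_le_sum (f := fun i => β (u i).2)
        (fun i _ => hβp _) (Finset.mem_univ i)
    exact Nat.lt_succ_of_le (hβ.le_iff_le.1 this)
  simp only [Set.mem_iUnion, Finset.mem_range]
  exact ⟨m, hm, fun i => (⟨(u i).1, hk i⟩, ⟨(u i).2, hj i⟩), rfl⟩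

/-- `∑_{m ≥ 2} ∑ 𝒢_m(q_{j_1,l_1}, …, q_{j_m,l_m})` over all indices with `∑ μ_{j_i} = μ_k` and
`∑ β_{l_i} = β_j`. -/
noncomputable def nonlinearTerm {n : ℕ} (μ β : ℕ → ℝ)
    (𝒢 : (m : ℕ) → MultilinearMap ℝ (fun _ : Fin m => EuclideanSpace ℝ (Fin n))
      (EuclideanSpace ℝ (Fin n)))
    (q : ℕ → ℕ → ℝ → EuclideanSpace ℝ (Fin n)) (k j : ℕ) (z : ℝ) : EuclideanSpace ℝ (Fin n) :=
  ∑ᶠ s ∈ resonantTuples μ β k j, 𝒢 s.1 (fun i => q (s.2 i).1 (s.2 i).2 z)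

open Classical in
/-- The correction `χ_{k,j}`. It is `0` if no `l` has `μ_l + 1 = μ_k`. Otherwise it is
`μ_l q_{l,j}`, plus `β_i q_{l,i} - q'_{l,i}` in case some `i` has `β_i + 1 = β_j`.
Both `l` and `i` are unique when `μ` and `β` are strictly increasing. -/
noncomputable def correctionTerm {n : ℕ} (μ β : ℕ → ℝ)
    (q : ℕ → ℕ → ℝ → EuclideanSpace ℝ (Fin n)) (k j : ℕ) (z : ℝ) : EuclideanSpace ℝ (Fin n) :=
  if hk : ∃ l, μ l + 1 = μ k then
    μ hk.choose • q hk.choose j z +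
      (if hj : ∃ i, β i + 1 = β j then
        β hj.choose • q hk.choose hj.choose z - deriv (q hk.choose hj.choose) z
      else 0)
  else 0

/-! The recursion determines the `q k j` outright, independently of `y`, since its right-hand side
at `k` involves only smaller first indices. For fixed `N` let `Y` be the finite sum of the terms
with `k ≤ N`. Substituting `Y` into the equation, multilinearity produces `nonlinearTerm` and
differentiation produces `correctionTerm`; the recursion cancels every coefficient up to `μ N`, so
`Y` solves the equation up to `O(t^(-ν))` for some `ν > μ N`.

The difference `z = y - Y` satisfies `z' = -A z + h₁ + h₂`. Here `h₁` is the difference of the sums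
of the `𝒢 m` at `y` and at `Y`; it is `o(z)` because all degrees are at least 2 and `y`, `Y` tend to
0. The term `h₂` collects the residual of `Y` and the Taylor remainder of `G` along `y`. The decay
lemma `isBigO_rpow_of_hasDerivAt_diagonalizable` then gives `z = O(t^(-ν))`, for each `N` directly,
without induction on `N`. The same lemma, with `h₁ = G(y)` and `h₂ = f`, supplies the a priori decay
of `y` that makes the Taylor remainder small. -/

/-! ### Power decay for perturbed linear equations -/

/-- For large `t`, `K * t ^ (-a)` is a supersolution of the linear inequality, so multiplying its
difference from `V` by the integrating factor `exp (lam * t)` gives a nonincreasing function. The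
initial discrepancy decays exponentially. -/
theorem eventually_le_rpow_of_hasDerivAt_le {V V' : ℝ → ℝ} {lam C a : ℝ} (hlam : 0 < lam)
    (hV : ∀ᶠ t in atTop, HasDerivAt V (V' t) t ∧ V' t ≤ -lam * V t + C * t ^ (-a)) :
    ∃ K, ∀ᶠ t in atTop, V t ≤ K * t ^ (-a) := by
  -- The factor 2 pays for the derivative of `t ^ (-a)`, which uses up at most half of `lam` once `t
  -- ≥ 2 * |a| / lam`.
  set K := 2 * |C| / lam with hK
  obtain ⟨T, hT⟩ := eventually_atTop.1
    ((hV.and (eventually_ge_atTop (2 * |a| / lam))).and (eventually_gt_atTop 0))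
  have hder : ∀ t, T ≤ t → HasDerivAt (fun t => Real.exp (lam * t) * (V t - K * t ^ (-a)))
      (Real.exp (lam * t) * (lam * 1) * (V t - K * t ^ (-a)) +
        Real.exp (lam * t) * (V' t - K * (-a * t ^ (-a - 1)))) t := fun t ht => by
    obtain ⟨⟨⟨h1, -⟩, -⟩, h0⟩ := hT t ht
    exact (((hasDerivAt_id t).const_mul lam).exp).mul
      (h1.sub ((Real.hasDerivAt_rpow_const (Or.inl h0.ne')).const_mul K))
  have hanti : AntitoneOn (fun t => Real.exp (lam * t) * (V t - K * t ^ (-a))) (Set.Ici T) := by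
    refine antitoneOn_of_hasDerivWithinAt_nonpos (convex_Ici T)
      (fun t ht => (hder t ht).continuousAt.continuousWithinAt)
      (fun t ht => (hder t (interior_subset ht)).hasDerivWithinAt) fun t ht => ?_
    obtain ⟨⟨⟨-, h1⟩, h2⟩, h0⟩ := hT t (interior_subset ht)
    have hpos : 0 < t ^ (-a) := Real.rpow_pos_of_pos h0 _
    have h3 : a / t ≤ lam / 2 := by
      rw [div_le_iff₀ h0]
      rw [div_le_iff₀ hlam] at h2
      linarith [le_abs_self a]
    have h4 : C ≤ K * (lam - a / t) := by
      have hK0 : 0 ≤ K := by positivity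
      calc C ≤ |C| := le_abs_self C
        _ = K * (lam / 2) := by rw [hK]; field_simp
        _ ≤ _ := by gcongr; linarith
    have h5 : t ^ (-a - 1) = t ^ (-a) / t := Real.rpow_sub_one h0.ne' _
    have h6 : Real.exp (lam * t) * (lam * 1) * (V t - K * t ^ (-a)) +
        Real.exp (lam * t) * (V' t - K * (-a * t ^ (-a - 1))) =
        Real.exp (lam * t) * ((V' t + lam * V t - C * t ^ (-a)) +
          (C - K * (lam - a / t)) * t ^ (-a)) := by
      rw [h5]; ring
    rw [h6]
    refine mul_nonpos_of_nonneg_of_nonpos (Real.exp_pos _).le (add_nonpos (by linarith) ?_)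
    exact mul_nonpos_of_nonpos_of_nonneg (by linarith) hpos.le
  set w := Real.exp (lam * T) * (V T - K * T ^ (-a))
  refine ⟨K + |w|, ?_⟩
  have hexp := (isLittleO_exp_neg_mul_rpow_atTop hlam (-a)).bound one_pos
  filter_upwards [eventually_ge_atTop T, hexp] with t ht he
  have h0 := (hT t ht).2
  have hpos : 0 < t ^ (-a) := Real.rpow_pos_of_pos h0 _
  rw [one_mul, Real.norm_of_nonneg (Real.exp_pos _).le, Real.norm_of_nonneg hpos.le] at he
  have h1 : Real.exp (lam * t) * (V t - K * t ^ (-a)) ≤ w :=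
    hanti (Set.mem_Ici.2 le_rfl) ht ht
  have h2 : V t - K * t ^ (-a) ≤ w * Real.exp (-lam * t) := by
    have : V t - K * t ^ (-a) =
        Real.exp (lam * t) * (V t - K * t ^ (-a)) * Real.exp (-lam * t) := by
      rw [mul_right_comm, ← Real.exp_add]; simp
    rw [this]
    gcongr
  have h3 : w * Real.exp (-lam * t) ≤ |w| * t ^ (-a) :=
    mul_le_mul (le_abs_self w) he (Real.exp_pos _).le (abs_nonneg w)
  linarith

/-- In the eigenbasis the linear part is coercive, so `‖S z‖ ^ 2` obeys the scalar inequality above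
with rate `2 * a`. Of the damping `2 * lam`, the terms `h₁` and `h₂` consume `lam / 2` each. -/
theorem isBigO_rpow_of_hasDerivAt_diagonalizable {n : ℕ} {A : Matrix (Fin n) (Fin n) ℝ}
    (hA : IsDiagonalizablePos A) {z h₁ h₂ : ℝ → EuclideanSpace ℝ (Fin n)} {a : ℝ}
    (hz : ∀ᶠ t in atTop,
      HasDerivAt z (-(Matrix.toEuclideanLin A (z t)) + h₁ t + h₂ t) t)
    (hh₁ : h₁ =o[atTop] z) (hh₂ : h₂ =O[atTop] fun t : ℝ => t ^ (-a)) :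
    z =O[atTop] fun t : ℝ => t ^ (-a) := by
  obtain ⟨S, Λ, hS, hΛ, rfl⟩ := hA
  have hSdet : IsUnit S.det := (Matrix.isUnit_iff_isUnit_det S).1 hS
  obtain ⟨lam, hlam, hlamΛ⟩ : ∃ lam : ℝ, 0 < lam ∧ ∀ i, lam ≤ Λ i := by
    rcases isEmpty_or_nonempty (Fin n) with h | h
    · exact ⟨1, one_pos, fun i => h.elim i⟩
    · obtain ⟨i, hi⟩ := Finite.exists_min Λ
      exact ⟨Λ i, hΛ i, hi⟩
  let s := (Matrix.toEuclideanLin S).toContinuousLinearMap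
  let s' := (Matrix.toEuclideanLin S⁻¹).toContinuousLinearMap
  have hss : ∀ v, s' (s v) = v := fun v => by
    simp [s, s', Matrix.toLpLin_apply, Matrix.mulVec_mulVec, Matrix.nonsing_inv_mul S hSdet]
  have hsA : ∀ v, s (Matrix.toEuclideanLin (S⁻¹ * Matrix.diagonal Λ * S) v) =
      Matrix.toEuclideanLin (Matrix.diagonal Λ) (s v) := fun v => by
    simp [s, Matrix.toLpLin_apply, Matrix.mulVec_mulVec, ← Matrix.mul_assoc,
      Matrix.mul_nonsing_inv S hSdet]
  have hinner : ∀ v : EuclideanSpace ℝ (Fin n),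
      lam * ‖v‖ ^ 2 ≤ inner ℝ v (Matrix.toEuclideanLin (Matrix.diagonal Λ) v) := fun v => by
    rw [EuclideanSpace.norm_sq_eq, PiLp.inner_apply, Finset.mul_sum]
    refine Finset.sum_le_sum fun i _ => ?_
    simp only [Matrix.toLpLin_apply, Matrix.mulVec_diagonal, Real.norm_eq_abs, sq_abs,
      RCLike.inner_apply, conj_trivial]
    nlinarith [hlamΛ i, sq_nonneg (v i)]
  obtain ⟨C, hC0, hC⟩ := hh₂.exists_pos
  -- Passing between `z` and `s z` costs `‖s‖ * ‖s'‖`; the `+ 1` keeps the denominator positive even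
  -- in dimension 0.
  have hε : 0 < lam / (4 * (‖s‖ * ‖s'‖ + 1)) := by positivity
  obtain ⟨K, hK⟩ := eventually_le_rpow_of_hasDerivAt_le (V := fun t => ‖s (z t)‖ ^ 2)
    (V' := fun t => 2 * inner ℝ (s (z t)) (s
      (-(Matrix.toEuclideanLin (S⁻¹ * Matrix.diagonal Λ * S) (z t)) + h₁ t + h₂ t)))
    (C := 2 * (‖s‖ * C) ^ 2 / lam) (a := 2 * a) hlam (by
    filter_upwards [hz, hh₁.bound hε, hC.bound, eventually_gt_atTop 0] with t h1 h2 h3 h0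
    refine ⟨((s.hasFDerivAt.comp_hasDerivAt t h1)).norm_sq, ?_⟩
    have hpos : 0 < t ^ (-a) := Real.rpow_pos_of_pos h0 _
    rw [Real.norm_of_nonneg hpos.le] at h3
    have hsq : t ^ (-(2 * a)) = (t ^ (-a)) ^ 2 := by
      rw [← Real.rpow_natCast, ← Real.rpow_mul h0.le]; congr 1; push_cast; ring
    rw [map_add, map_add, map_neg, hsA, inner_add_right, inner_add_right, inner_neg_right, hsq]
    set x := ‖s (z t)‖ with hx
    set r := t ^ (-a)
    have i1 : lam * x ^ 2 ≤ _ := hinner (s (z t))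
    have i2 : inner ℝ (s (z t)) (s (h₁ t)) ≤ lam / 4 * x ^ 2 := by
      have hzx : ‖z t‖ ≤ ‖s'‖ * x := by
        conv_lhs => rw [← hss (z t)]
        exact s'.le_opNorm _
      calc inner ℝ (s (z t)) (s (h₁ t)) ≤ x * ‖s (h₁ t)‖ := real_inner_le_norm _ _
        _ ≤ x * (‖s‖ * (lam / (4 * (‖s‖ * ‖s'‖ + 1)) * (‖s'‖ * x))) := by
            gcongr
            refine (s.le_opNorm _).trans ?_
            gcongr
            exact h2.trans (by gcongr)
        _ = lam / 4 * ((‖s‖ * ‖s'‖) / (‖s‖ * ‖s'‖ + 1)) * x ^ 2 := by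
            field_simp
        _ ≤ lam / 4 * 1 * x ^ 2 := by
            gcongr
            rw [div_le_one (by positivity)]
            linarith
        _ = _ := by ring
    have i3 : inner ℝ (s (z t)) (s (h₂ t)) ≤ x * (‖s‖ * C * r) := by
      refine (real_inner_le_norm _ _).trans ?_
      gcongr
      refine (s.le_opNorm _).trans ?_
      rw [mul_assoc]
      gcongr
    -- Young's inequality.
    have i4 : x * (‖s‖ * C * r) ≤ lam / 4 * x ^ 2 + (‖s‖ * C) ^ 2 / lam * r ^ 2 := by
      have : lam / 4 * x ^ 2 + (‖s‖ * C) ^ 2 / lam * r ^ 2 - x * (‖s‖ * C * r) =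
          (lam * x / 2 - ‖s‖ * C * r) ^ 2 / lam := by
        field_simp; ring
      have : 0 ≤ (lam * x / 2 - ‖s‖ * C * r) ^ 2 / lam := by positivity
      linarith
    have i5 : 2 * (‖s‖ * C) ^ 2 / lam * r ^ 2 = 2 * ((‖s‖ * C) ^ 2 / lam * r ^ 2) := by ring
    rw [i5]
    linarith)
  refine IsBigO.of_bound (‖s'‖ * √|K|) ?_
  filter_upwards [hK, eventually_gt_atTop 0] with t h1 h0
  have hpos : 0 < t ^ (-a) := Real.rpow_pos_of_pos h0 _
  have hsq : t ^ (-(2 * a)) = (t ^ (-a)) ^ 2 := by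
    rw [← Real.rpow_natCast, ← Real.rpow_mul h0.le]; congr 1; push_cast; ring
  rw [Real.norm_of_nonneg hpos.le]
  have h2 : ‖s (z t)‖ ≤ √|K| * t ^ (-a) := by
    refine abs_le_of_sq_le_sq' ?_ (by positivity) |>.2
    rw [mul_pow, Real.sq_sqrt (abs_nonneg K), ← hsq]
    refine h1.trans ?_
    have : 0 ≤ t ^ (-(2 * a)) := by rw [hsq]; positivity
    gcongr
    exact le_abs_self K
  calc ‖z t‖ = ‖s' (s (z t))‖ := by rw [hss]
    _ ≤ ‖s'‖ * ‖s (z t)‖ := s'.le_opNorm _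
    _ ≤ ‖s'‖ * (√|K| * t ^ (-a)) := by gcongr
    _ = _ := by ring

/-! ### Closure properties of vector polynomials -/

namespace IsVectorPolynomial

variable {X Y : Type*} [AddCommGroup X] [Module ℝ X] [AddCommGroup Y] [Module ℝ Y]

theorem monomial (e : ℕ) (a : X) : IsVectorPolynomial fun z : ℝ => z ^ e • a :=
  ⟨e, Pi.single e a, fun z => by
    rw [Finset.sum_eq_single e] <;> simp +contextual⟩

theorem add {p q : ℝ → X} (hp : IsVectorPolynomial p) (hq : IsVectorPolynomial q) :
    IsVectorPolynomial fun z => p z + q z := by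
  obtain ⟨N, a, ha⟩ := hp
  obtain ⟨M, b, hb⟩ := hq
  have key : ∀ (K L : ℕ) (c : ℕ → X) (z : ℝ), K ≤ L →
      ∑ i ∈ Finset.range (K + 1), z ^ i • c i =
        ∑ i ∈ Finset.range (L + 1), z ^ i • (if i ≤ K then c i else 0) := fun K L c z h => by
    rw [← Finset.sum_subset (Finset.range_subset_range.2 (Nat.add_le_add_right h 1))]
    · refine Finset.sum_congr rfl fun i hi => ?_
      rw [if_pos (Nat.lt_succ_iff.1 (Finset.mem_range.1 hi))]
    · intro i _ hi
      rw [if_neg fun h => hi (Finset.mem_range.2 (Nat.lt_succ_iff.2 h)), smul_zero]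
  refine ⟨max N M, fun i => (if i ≤ N then a i else 0) + (if i ≤ M then b i else 0), fun z => ?_⟩
  simp only [ha, hb]
  rw [key N (max N M) a z (le_max_left _ _), key M (max N M) b z (le_max_right _ _),
    ← Finset.sum_add_distrib]
  simp only [smul_add]

theorem zero : IsVectorPolynomial fun _ : ℝ => (0 : X) := ⟨0, 0, by simp⟩

theorem sum {ι : Type*} (s : Finset ι) {p : ι → ℝ → X}
    (hp : ∀ i ∈ s, IsVectorPolynomial (p i)) : IsVectorPolynomial fun z => ∑ i ∈ s, p i z := by
  classical
  induction s using Finset.induction_on with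
  | empty => simpa using zero
  | insert i s hi ih =>
    simp only [Finset.sum_insert hi]
    exact (hp i (Finset.mem_insert_self i s)).add
      (ih fun j hj => hp j (Finset.mem_insert_of_mem hj))

theorem map {p : ℝ → X} (hp : IsVectorPolynomial p) (T : X →ₗ[ℝ] Y) :
    IsVectorPolynomial fun z => T (p z) := by
  obtain ⟨N, a, ha⟩ := hp
  exact ⟨N, fun i => T (a i), fun z => by simp [ha]⟩

theorem const_smul {p : ℝ → X} (hp : IsVectorPolynomial p) (r : ℝ) :
    IsVectorPolynomial fun z => r • p z := by
  simpa using hp.map (LinearMap.lsmul ℝ X r)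

theorem sub {p q : ℝ → X} (hp : IsVectorPolynomial p) (hq : IsVectorPolynomial q) :
    IsVectorPolynomial fun z => p z - q z := by
  simpa [sub_eq_add_neg] using hp.add (hq.const_smul (-1))

theorem multilinear {m : ℕ} (M : MultilinearMap ℝ (fun _ : Fin m => X) Y) {p : Fin m → ℝ → X}
    (hp : ∀ i, IsVectorPolynomial (p i)) : IsVectorPolynomial fun z => M fun i => p i z := by
  classical
  choose N a ha using hp
  have : (fun z => M fun i => p i z) = fun z =>
      ∑ r ∈ Fintype.piFinset fun i => Finset.range (N i + 1),
        z ^ (∑ i, r i) • M fun i => a i (r i) := by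
    funext z
    simp only [ha]
    rw [MultilinearMap.map_sum_finset]
    refine Finset.sum_congr rfl fun r _ => ?_
    rw [MultilinearMap.map_smul_univ M (fun i => z ^ r i) fun i => a i (r i),
      Finset.prod_pow_eq_pow_sum]
  rw [this]
  exact sum _ fun r _ => monomial _ _

end IsVectorPolynomial

/-! ### Growth and derivatives of power-logarithm terms -/

section Normed

variable {X : Type*} [NormedAddCommGroup X] [NormedSpace ℝ X] {p : ℝ → X}

theorem IsVectorPolynomial.hasDerivAt (hp : IsVectorPolynomial p) (z : ℝ) :
    HasDerivAt p (deriv p z) z := by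
  obtain ⟨N, a, ha⟩ := hp
  obtain rfl : p = fun z => ∑ i ∈ Finset.range (N + 1), z ^ i • a i := funext ha
  refine DifferentiableAt.hasDerivAt ?_
  fun_prop

theorem IsVectorPolynomial.deriv (hp : IsVectorPolynomial p) : IsVectorPolynomial (deriv p) := by
  obtain ⟨N, a, ha⟩ := hp
  obtain rfl : p = fun z => ∑ i ∈ Finset.range (N + 1), z ^ i • a i := funext ha
  have : _root_.deriv (fun z : ℝ => ∑ i ∈ Finset.range (N + 1), z ^ i • a i) =
      fun z => ∑ i ∈ Finset.range (N + 1), z ^ (i - 1) • ((i : ℝ) • a i) := by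
    funext z
    refine HasDerivAt.deriv (HasDerivAt.fun_sum fun i _ => ?_)
    have h := (hasDerivAt_pow i z).smul_const (a i)
    convert h using 1
    rw [smul_smul, mul_comm]
  rw [this]
  exact sum _ fun i _ => monomial _ _

theorem IsVectorPolynomial.exists_norm_le (hp : IsVectorPolynomial p) :
    ∃ (C : ℝ) (d : ℕ), ∀ z, 1 ≤ z → ‖p z‖ ≤ C * z ^ d := by
  obtain ⟨N, a, ha⟩ := hp
  refine ⟨∑ i ∈ Finset.range (N + 1), ‖a i‖, N, fun z hz => ?_⟩
  rw [ha, Finset.sum_mul]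
  refine norm_sum_le_of_le _ fun i hi => ?_
  rw [norm_smul, norm_pow, Real.norm_of_nonneg (by linarith), mul_comm]
  gcongr
  exact Nat.lt_succ_iff.1 (Finset.mem_range.1 hi)

/-- `t^{-a} (ln t)^{-b} p(ln ln t)` -/
noncomputable def powLogTerm (a b : ℝ) (p : ℝ → X) (t : ℝ) : X :=
  t ^ (-a) • Real.log t ^ (-b) • p (Real.log (Real.log t))

/-- Powers of `ln ln t` are negligible against `ln t`, which is negligible against `t ^ ε`. -/
theorem isBigO_log_log (hp : IsVectorPolynomial p) {ε : ℝ} (hε : 0 < ε) :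
    (fun t => p (Real.log (Real.log t))) =O[atTop] fun t : ℝ => t ^ ε := by
  obtain ⟨C, d, h⟩ := hp.exists_norm_le
  have hll : Tendsto (fun t => Real.log (Real.log t)) atTop atTop :=
    Real.tendsto_log_atTop.comp Real.tendsto_log_atTop
  have h1 : (fun t => p (Real.log (Real.log t))) =O[atTop]
      fun t => Real.log (Real.log t) ^ d := by
    refine IsBigO.of_bound C ?_
    filter_upwards [hll.eventually_ge_atTop 1] with t ht
    rw [Real.norm_of_nonneg (by positivity)]
    exact h _ ht
  have h2 : (fun t => Real.log (Real.log t) ^ d) =O[atTop] Real.log :=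
    (Real.isLittleO_pow_log_id_atTop.comp_tendsto Real.tendsto_log_atTop).isBigO
  exact (h1.trans h2).trans (isLittleO_log_rpow_atTop hε).isBigO

theorem powLogTerm_isBigO (hp : IsVectorPolynomial p) {a b ν : ℝ} (hb : 0 ≤ b) (hν : ν < a) :
    powLogTerm a b p =O[atTop] fun t : ℝ => t ^ (-ν) := by
  have h1 : (fun t => Real.log t ^ (-b)) =O[atTop] fun _ => (1 : ℝ) := by
    refine IsBigO.of_bound 1 ?_
    filter_upwards [Real.tendsto_log_atTop.eventually_ge_atTop 1] with t ht
    rw [Real.norm_of_nonneg (by positivity), norm_one, one_mul]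
    exact Real.rpow_le_one_of_one_le_of_nonpos ht (by linarith)
  have h2 := (isBigO_refl (fun t : ℝ => t ^ (-a)) atTop).smul
    (h1.smul (isBigO_log_log hp (sub_pos.2 hν)))
  refine h2.congr' (Eventually.of_forall fun t => rfl) ?_
  filter_upwards [eventually_gt_atTop 0] with t ht
  rw [one_smul, smul_eq_mul, ← Real.rpow_add ht]
  congr 1; ring

/-- Both resulting terms have the same shape with shifted exponents; this is the source of
`correctionTerm` and of the need for unit increments. -/
theorem hasDerivAt_powLogTerm (hp : IsVectorPolynomial p) (a b : ℝ) {t : ℝ} (ht : 1 < t) :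
    HasDerivAt (powLogTerm a b p)
      (-(powLogTerm (a + 1) b (fun z => a • p z) t +
        powLogTerm (a + 1) (b + 1) (fun z => b • p z - deriv p z) t)) t := by
  have h0 : 0 < t := by linarith
  have hL : 0 < Real.log t := Real.log_pos ht
  have d1 := Real.hasDerivAt_rpow_const (p := -a) (Or.inl h0.ne')
  have dl := Real.hasDerivAt_log h0.ne'
  have d2 := dl.rpow_const (p := -b) (Or.inl hL.ne')
  have d3 := (hp.hasDerivAt _).scomp t (dl.log hL.ne')
  have e1 : t ^ (-a - 1) = t ^ (-(a + 1)) := by congr 1; ring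
  have e2 : Real.log t ^ (-b - 1) = Real.log t ^ (-(b + 1)) := by congr 1; ring
  have e3 : t ^ (-(a + 1)) = t ^ (-a) * t⁻¹ := by
    rw [← e1, Real.rpow_sub_one h0.ne', div_eq_mul_inv]
  have e4 : Real.log t ^ (-(b + 1)) = Real.log t ^ (-b) * (Real.log t)⁻¹ := by
    rw [← e2, Real.rpow_sub_one hL.ne', div_eq_mul_inv]
  refine (d1.smul (d2.smul d3)).congr_deriv ?_
  simp only [powLogTerm, e1, e2, e3, e4, Pi.smul_apply', Function.comp_apply]
  module

end Normed

/-! ### Calculus of truncated expansions -/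

theorem isBigO_rpow_neg_mono {a b : ℝ} (h : a ≤ b) :
    (fun t : ℝ => t ^ (-b)) =O[atTop] fun t : ℝ => t ^ (-a) := by
  refine IsBigO.of_bound 1 ?_
  filter_upwards [eventually_ge_atTop 1] with t ht
  rw [one_mul, Real.norm_of_nonneg (by positivity), Real.norm_of_nonneg (by positivity)]
  exact Real.rpow_le_rpow_of_exponent_le ht (by linarith)

/-- The expansion of `HasPowerLogLogExpansion`, required for the single index `N` only. -/
def HasExpansionUpTo {n : ℕ} (μ β : ℕ → ℝ) (N : ℕ) (g : ℝ → EuclideanSpace ℝ (Fin n))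
    (c : ℕ → ℕ → ℝ → EuclideanSpace ℝ (Fin n)) : Prop :=
  (∀ k ≤ N, {j | c k j ≠ 0}.Finite) ∧ ∃ ν : ℝ, μ N < ν ∧
    (fun t : ℝ => g t - ∑ k ∈ Finset.range (N + 1), (t ^ (-μ k)) • logCoefficient β c k t)
      =O[atTop] (fun t : ℝ => t ^ (-ν))

section

variable {n : ℕ} {μ β : ℕ → ℝ} {N : ℕ}

theorem logCoefficient_eq_sum {c : ℕ → ℕ → ℝ → EuclideanSpace ℝ (Fin n)} {k : ℕ} {s : Finset ℕ}
    (hs : {j | c k j ≠ 0} ⊆ s) (t : ℝ) :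
    logCoefficient β c k t =
      ∑ j ∈ s, (Real.log t ^ (-β j)) • c k j (Real.log (Real.log t)) := by
  refine finsum_eq_sum_of_support_subset _ fun j hj => hs fun h => hj ?_
  simp [h]

theorem logCoefficient_add {c d : ℕ → ℕ → ℝ → EuclideanSpace ℝ (Fin n)} {k : ℕ}
    (hc : {j | c k j ≠ 0}.Finite) (hd : {j | d k j ≠ 0}.Finite) (t : ℝ) :
    logCoefficient β (c + d) k t = logCoefficient β c k t + logCoefficient β d k t := by
  classical
  have hs : ∀ j, j ∉ hc.toFinset ∪ hd.toFinset → c k j = 0 ∧ d k j = 0 := fun j hj => by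
    simpa [not_or] using hj
  rw [logCoefficient_eq_sum (s := hc.toFinset ∪ hd.toFinset) (c := c + d),
    logCoefficient_eq_sum (s := hc.toFinset ∪ hd.toFinset) (c := c),
    logCoefficient_eq_sum (s := hc.toFinset ∪ hd.toFinset) (c := d), ← Finset.sum_add_distrib]
  · simp
  · exact fun j hj => by_contra fun h => hj (hs j h).2
  · exact fun j hj => by_contra fun h => hj (hs j h).1
  · exact fun j hj => by_contra fun h => hj (by simp [hs j h])

namespace HasExpansionUpTo

variable {g g' : ℝ → EuclideanSpace ℝ (Fin n)} {c c' : ℕ → ℕ → ℝ → EuclideanSpace ℝ (Fin n)}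

theorem congr (h : HasExpansionUpTo μ β N g c) (hg : ∀ᶠ t in atTop, g t = g' t)
    (hc : ∀ k ≤ N, ∀ j z, c k j z = c' k j z) : HasExpansionUpTo μ β N g' c' := by
  have hcc : ∀ k ≤ N, c k = c' k := fun k hk => funext fun j => funext fun z => hc k hk j z
  obtain ⟨hfin, ν, hν, hO⟩ := h
  refine ⟨fun k hk => by simpa [hcc k hk] using hfin k hk, ν, hν, hO.congr' ?_ .rfl⟩
  filter_upwards [hg] with t ht
  rw [ht]
  congr 1
  refine Finset.sum_congr rfl fun k hk => ?_
  simp only [logCoefficient, hcc k (Nat.lt_succ_iff.1 (Finset.mem_range.1 hk))]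

theorem add (h : HasExpansionUpTo μ β N g c) (h' : HasExpansionUpTo μ β N g' c') :
    HasExpansionUpTo μ β N (fun t => g t + g' t) (c + c') := by
  obtain ⟨hfin, ν, hν, hO⟩ := h
  obtain ⟨hfin', ν', hν', hO'⟩ := h'
  refine ⟨fun k hk => ((hfin k hk).union (hfin' k hk)).subset fun j hj => ?_, min ν ν',
    lt_min hν hν', ?_⟩
  · by_contra h
    simp only [Set.mem_union, Set.mem_ofPred_eq, not_or, not_not] at h
    exact hj (by simp [h])
  · refine ((hO.trans (isBigO_rpow_neg_mono (min_le_left _ _))).add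
      (hO'.trans (isBigO_rpow_neg_mono (min_le_right _ _)))).congr_left fun t => ?_
    rw [sub_add_sub_comm, ← Finset.sum_add_distrib]
    congr 1
    refine Finset.sum_congr rfl fun k hk => ?_
    have hk := Nat.lt_succ_iff.1 (Finset.mem_range.1 hk)
    rw [logCoefficient_add (hfin k hk) (hfin' k hk), smul_add]

theorem of_isBigO {ν : ℝ} (hν : μ N < ν) (h : g =O[atTop] fun t : ℝ => t ^ (-ν)) :
    HasExpansionUpTo μ β N g 0 :=
  ⟨by simp, ν, hν, by simpa [logCoefficient] using h⟩

/-- Cancellation of coefficients is thereby converted into decay beyond `μ N`. -/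
theorem isBigO (h : HasExpansionUpTo μ β N g 0) :
    ∃ ν, μ N < ν ∧ g =O[atTop] fun t : ℝ => t ^ (-ν) := by
  obtain ⟨-, ν, hν, hO⟩ := h
  exact ⟨ν, hν, by simpa [logCoefficient] using hO⟩

theorem powLogTerm (hμ : StrictMono μ) (hβ0 : ∀ j, 0 ≤ β j) {p : ℝ → EuclideanSpace ℝ (Fin n)}
    (hp : IsVectorPolynomial p) (k j : ℕ) :
    HasExpansionUpTo μ β N (powLogTerm (μ k) (β j) p) (Pi.single k (Pi.single j p)) := by
  have hfin : ∀ k', {j' | (Pi.single k (Pi.single j p) :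
      ℕ → ℕ → ℝ → EuclideanSpace ℝ (Fin n)) k' j' ≠ 0} ⊆ ({j} : Finset ℕ) := fun k' j' h => by
    by_contra hj
    have hj : j' ≠ j := by simpa using hj
    rcases eq_or_ne k' k with rfl | hk
    · simp [hj] at h
    · simp [hk] at h
  have hlog : ∀ k' t, logCoefficient β (Pi.single k (Pi.single j p)) k' t =
      if k' = k then (Real.log t ^ (-β j)) • p (Real.log (Real.log t)) else 0 := fun k' t => by
    rw [logCoefficient_eq_sum (hfin k'), Finset.sum_singleton]
    split_ifs with h
    · simp [h]
    · simp [h]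
  refine ⟨fun k' _ => (Finset.finite_toSet _).subset (hfin k'), ?_⟩
  simp only [hlog]
  rcases le_or_gt k N with hk | hk
  · refine ⟨μ N + 1, by linarith, ?_⟩
    refine (isBigO_zero _ _).congr_left fun t => ?_
    simp [_root_.powLogTerm, Nat.lt_succ_iff.2 hk]
  · have := hμ hk
    -- The midpoint leaves room to absorb the polynomial in `ln ln t`.
    refine ⟨(μ N + μ k) / 2, by linarith, ?_⟩
    refine (powLogTerm_isBigO hp (hβ0 j) (by linarith : (μ N + μ k) / 2 < μ k)).congr_left
      fun t => ?_
    simp [Nat.not_lt.2 (Nat.succ_le_of_lt hk)]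

/-- The labels `κ`, `l` need not be injective, and labels `κ i > N` are allowed: those terms fall
into the remainder. -/
theorem sum_powLogTerm (hμ : StrictMono μ) (hβ0 : ∀ j, 0 ≤ β j) {ι : Type*} (s : Finset ι)
    (κ l : ι → ℕ) {p : ι → ℝ → EuclideanSpace ℝ (Fin n)}
    (hp : ∀ i ∈ s, IsVectorPolynomial (p i)) :
    HasExpansionUpTo μ β N
      (fun t => ∑ i ∈ s, _root_.powLogTerm (μ (κ i)) (β (l i)) (p i) t)
      (fun k j z => ∑ i ∈ s with κ i = k ∧ l i = j, p i z) := by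
  classical
  induction s using Finset.induction_on with
  | empty =>
    exact (of_isBigO (lt_add_one (μ N)) (isBigO_zero _ _)).congr
      (Eventually.of_forall fun t => by simp) (by simp)
  | insert i s hi ih =>
    refine ((powLogTerm hμ hβ0 (hp i (Finset.mem_insert_self i s)) (κ i) (l i)).add
      (ih fun j hj => hp j (Finset.mem_insert_of_mem hj))).congr
      (Eventually.of_forall fun t => by rw [Finset.sum_insert hi]) fun k _ j z => ?_
    simp only [Pi.add_apply, Pi.single_apply, Finset.sum_filter, Finset.sum_insert hi]
    congr 1
    by_cases h : k = κ i
    · by_cases h' : j = l i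
      · subst h h'; simp
      · simp [h', Ne.symm h', h]
    · simp [h, Ne.symm h]

end HasExpansionUpTo

end

/-! ### Multilinear maps and homogeneous polynomials -/

theorem MultilinearMap.exists_norm_le_prod {n m : ℕ} {Y : Type*} [NormedAddCommGroup Y]
    [NormedSpace ℝ Y] (M : MultilinearMap ℝ (fun _ : Fin m => EuclideanSpace ℝ (Fin n)) Y) :
    ∃ C, 0 ≤ C ∧ ∀ v, ‖M v‖ ≤ C * ∏ i, ‖v i‖ := by
  classical
  let e := EuclideanSpace.basisFun (Fin n) ℝ
  refine ⟨∑ r : Fin m → Fin n, ‖M fun i => e (r i)‖,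
    Finset.sum_nonneg fun _ _ => norm_nonneg _, fun v => ?_⟩
  have hv : v = fun i => ∑ l, v i l • e l := by
    funext i
    simpa only [e, EuclideanSpace.basisFun_repr] using (e.sum_repr (v i)).symm
  conv_lhs => rw [hv]
  rw [M.map_sum, Finset.sum_mul]
  refine norm_sum_le_of_le _ fun r _ => ?_
  rw [M.map_smul_univ (fun i => v i (r i)) fun i => e (r i), norm_smul, norm_prod, mul_comm]
  gcongr with i
  exact PiLp.norm_apply_le (v i) (r i)

/-- The Lipschitz constant on the segment of scales `max ‖u‖ ‖v‖` is of order `max ‖u‖ ‖v‖ ^ (m -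
1)`, which tends to 0 because `m ≥ 2`. -/
theorem MultilinearMap.diag_sub_diag_isLittleO {n m : ℕ} {Y : Type*} [NormedAddCommGroup Y]
    [NormedSpace ℝ Y] (M : MultilinearMap ℝ (fun _ : Fin m => EuclideanSpace ℝ (Fin n)) Y)
    (hm : 2 ≤ m) {ι : Type*} {l : Filter ι} {u v : ι → EuclideanSpace ℝ (Fin n)}
    (hu : Tendsto u l (𝓝 0)) (hv : Tendsto v l (𝓝 0)) :
    (fun t => M (fun _ => u t) - M fun _ => v t) =o[l] fun t => u t - v t := by
  obtain ⟨C, hC0, hC⟩ := M.exists_norm_le_prod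
  have : Nonempty (Fin m) := ⟨⟨0, by omega⟩⟩
  have h1 : Tendsto (fun t => C * m * max ‖u t‖ ‖v t‖ ^ (m - 1)) l (𝓝 0) := by
    have h := ((hu.norm.max hv.norm).pow (m - 1)).const_mul (C * m)
    simpa [show m - 1 ≠ 0 by omega] using h
  have h2 : (fun t => C * m * max ‖u t‖ ‖v t‖ ^ (m - 1)) =o[l] fun _ => (1 : ℝ) :=
    (isLittleO_one_iff ℝ).2 h1
  refine IsBigO.trans_isLittleO (IsBigO.of_bound 1 (Eventually.of_forall fun t => ?_))
    ((h2.mul_isBigO (isBigO_refl (fun t => ‖u t - v t‖) l)).congr_right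
      (g₂ := fun t => ‖u t - v t‖) fun t => one_mul _).of_norm_right
  have h3 := M.norm_image_sub_le_of_bound hC0 hC (fun _ => u t) fun _ => v t
  have h4 : ‖(fun _ : Fin m => u t) - fun _ => v t‖ = ‖u t - v t‖ :=
    pi_norm_const (u t - v t)
  rw [h4, pi_norm_const, pi_norm_const, Fintype.card_fin] at h3
  rw [one_mul, Real.norm_of_nonneg (by positivity)]
  exact h3

/-- A monomial of degree `m` is a product of `m` coordinates, listed with multiplicity; giving each
factor its own argument makes it multilinear. -/
theorem MvPolynomial.IsHomogeneous.exists_multilinearMap {σ : Type*} {m : ℕ}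
    {P : MvPolynomial σ ℝ} (hP : P.IsHomogeneous m) :
    ∃ M : MultilinearMap ℝ (fun _ : Fin m => σ → ℝ) ℝ,
      ∀ v, M (fun _ => v) = MvPolynomial.eval v P := by
  classical
  have key : ∀ d : σ →₀ ℕ, d.degree = m → ∃ M : MultilinearMap ℝ (fun _ : Fin m => σ → ℝ) ℝ,
      ∀ v, M (fun _ => v) = d.prod fun i e => v i ^ e := fun d hd => by
    obtain ⟨L, hL⟩ : ∃ L : List σ, (L : Multiset σ) = Finsupp.toMultiset d :=
      Quotient.exists_rep _
    have hlen : L.length = m := by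
      rw [← Multiset.coe_card, hL, Finsupp.card_toMultiset, ← hd]; rfl
    subst hlen
    refine ⟨(MultilinearMap.mkPiAlgebra ℝ (Fin L.length) ℝ).compLinearMap
      fun i => LinearMap.proj (L.get i), fun v => ?_⟩
    have : (d.prod fun i e => v i ^ e) = (L.map v).prod := by
      rw [← Multiset.prod_coe, ← Multiset.map_coe, hL, Finsupp.toMultiset_map,
        Finsupp.prod_toMultiset]
      rw [Finsupp.prod_mapDomain_index] <;> simp [pow_add]
    rw [this]
    simp [← List.prod_ofFn]
  choose! M hM using key
  refine ⟨∑ d ∈ P.support, P.coeff d • M d, fun v => ?_⟩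
  rw [MvPolynomial.eval_eq, sum_apply]
  refine Finset.sum_congr rfl fun d hd => ?_
  have hdeg : d.degree = m := by
    rw [Finsupp.degree_eq_weight_one]; exact hP (MvPolynomial.mem_support_iff.1 hd)
  rw [smul_apply, hM d hdeg, smul_eq_mul]
  rfl

theorem IsHomogeneousPolynomialMap.exists_multilinearMap {n m : ℕ}
    {g : EuclideanSpace ℝ (Fin n) → EuclideanSpace ℝ (Fin n)}
    (hg : IsHomogeneousPolynomialMap m g) :
    ∃ M : MultilinearMap ℝ (fun _ : Fin m => EuclideanSpace ℝ (Fin n))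
      (EuclideanSpace ℝ (Fin n)), ∀ v, M (fun _ => v) = g v := by
  choose P hP hgP using hg
  choose M hM using fun i => (hP i).exists_multilinearMap
  let e := (WithLp.linearEquiv 2 ℝ (Fin n → ℝ))
  refine ⟨e.symm.toLinearMap.compMultilinearMap
    ((MultilinearMap.pi M).compLinearMap fun _ => e.toLinearMap), fun v => ?_⟩
  ext i
  rw [hgP, ← hM]
  rfl

/-! ### The recursion for the coefficients -/

theorem exists_eq_of_causal {X : Type*} [Inhabited X] (Φ : (ℕ → X) → ℕ → X)
    (h : ∀ q q' k, (∀ i < k, q i = q' i) → Φ q k = Φ q' k) : ∃ q, ∀ k, q k = Φ q k := by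
  -- The values `default` at indices `≥ k` are irrelevant by causality.
  let F : (k : ℕ) → ((i : ℕ) → i < k → X) → X := fun k r =>
    Φ (fun i => if hi : i < k then r i hi else default) k
  refine ⟨wellFounded_lt.fix F, fun k => ?_⟩
  rw [WellFounded.fix_eq]
  exact h _ _ k fun i hi => by simp [hi]

theorem Finset.sum_filter_eq_of_unique {ι E : Type*} [AddCommMonoid E] (s : Finset ι)
    (P : ι → Prop) [DecidablePred P] (f : ι → E) (x : ι) (h : ∀ i, P i ↔ i = x)
    (h0 : x ∉ s → f x = 0) : ∑ i ∈ s with P i, f i = f x := by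
  refine Finset.sum_eq_single x (fun i hi hix => absurd ((h i).1 (Finset.mem_filter.1 hi).2) hix)
    fun hx => h0 fun hs => hx (Finset.mem_filter.2 ⟨hs, (h x).2 rfl⟩)

theorem PreservesAddition.exists_eq_sum {μ : ℕ → ℝ} (h : PreservesAddition (Set.range μ))
    {m : ℕ} (hm : 0 < m) (u : Fin m → ℕ) : ∃ k, μ k = ∑ i, μ (u i) := by
  have : Nonempty (Fin m) := ⟨⟨0, hm⟩⟩
  exact Finset.sum_induction_nonempty (fun i => μ (u i)) (· ∈ Set.range μ)
    (fun a b ha hb => h a ha b hb)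
    Finset.univ_nonempty fun i _ => ⟨u i, rfl⟩

section

variable {n : ℕ} {μ β : ℕ → ℝ} {k j : ℕ}
  {𝒢 : (m : ℕ) → MultilinearMap ℝ (fun _ : Fin m => EuclideanSpace ℝ (Fin n))
    (EuclideanSpace ℝ (Fin n))}
  {q : ℕ → ℕ → ℝ → EuclideanSpace ℝ (Fin n)}

/-- There are at least two summands and all are positive, so each is smaller than the total. This
makes the recursion causal. -/
theorem fst_lt_of_mem_resonantTuples (hμ : StrictMono μ) (hμ0 : 0 < μ 0)
    {s : Σ m : ℕ, Fin m → ℕ × ℕ} (hs : s ∈ resonantTuples μ β k j) (i : Fin s.1) :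
    (s.2 i).1 < k := by
  obtain ⟨h2, h, -⟩ := hs
  have hpos : ∀ l, 0 < μ l := fun l => hμ0.trans_le (hμ.monotone (Nat.zero_le l))
  obtain ⟨i', hi'⟩ : ∃ i' : Fin s.1, i' ≠ i := by
    have : Nontrivial (Fin s.1) := Fin.nontrivial_iff_two_le.2 h2
    exact exists_ne i
  rw [← hμ.lt_iff_lt, ← h]
  exact Finset.single_lt_sum (f := fun i => μ (s.2 i).1) hi' (Finset.mem_univ i)
    (Finset.mem_univ i') (hpos _) fun l _ _ => (hpos _).le

theorem length_le_of_mem_resonantTuples (hμ : StrictMono μ) (hμ0 : 0 < μ 0) {M : ℕ}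
    (hM : μ k < M * μ 0) {s : Σ m : ℕ, Fin m → ℕ × ℕ} (hs : s ∈ resonantTuples μ β k j) :
    s.1 ≤ M := by
  have h3 : (s.1 : ℝ) * μ 0 ≤ μ k := by
    rw [← hs.2.1]
    simpa using Finset.card_nsmul_le_sum Finset.univ (fun i => μ (s.2 i).1) (μ 0)
      fun i _ => hμ.monotone (Nat.zero_le _)
  exact_mod_cast (lt_of_mul_lt_mul_right (h3.trans_lt hM) hμ0.le).le

/-- The finite set does not depend on `j`. This yields finite support in `j` and lets the infinite
family of tuples be compared with a finite product expansion. -/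
theorem mem_sigma_of_mem_resonantTuples (hμ : StrictMono μ) (hμ0 : 0 < μ 0)
    {F : Finset (ℕ × ℕ)} (hF : ∀ x : ℕ × ℕ, x.1 < k → q x.1 x.2 ≠ 0 → x ∈ F) {M : ℕ}
    (hM : μ k < M * μ 0) {s : Σ m : ℕ, Fin m → ℕ × ℕ} (hs : s ∈ resonantTuples μ β k j) {z : ℝ}
    (hne : 𝒢 s.1 (fun i => q (s.2 i).1 (s.2 i).2 z) ≠ 0) :
    s ∈ (Finset.Icc 2 M).sigma fun m => Fintype.piFinset fun _ : Fin m => F := by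
  rw [Finset.mem_sigma, Finset.mem_Icc, Fintype.mem_piFinset]
  refine ⟨⟨hs.1, length_le_of_mem_resonantTuples hμ hμ0 hM hs⟩, fun i =>
    hF _ (fst_lt_of_mem_resonantTuples hμ hμ0 hs i) fun h0 => hne ?_⟩
  exact (𝒢 s.1).map_coord_zero i (by simp [h0])

theorem nonlinearTerm_congr (hμ : StrictMono μ) (hμ0 : 0 < μ 0)
    {q' : ℕ → ℕ → ℝ → EuclideanSpace ℝ (Fin n)} (h : ∀ i < k, q i = q' i) (z : ℝ) :
    nonlinearTerm μ β 𝒢 q k j z = nonlinearTerm μ β 𝒢 q' k j z := by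
  refine finsum_mem_congr rfl fun s hs => ?_
  simp only [h _ (fst_lt_of_mem_resonantTuples hμ hμ0 hs _)]

theorem correctionTerm_eq_zero (h : ¬∃ l, μ l + 1 = μ k) (z : ℝ) :
    correctionTerm μ β q k j z = 0 := dif_neg h

theorem correctionTerm_of_add_one (hμ : StrictMono μ) {l : ℕ} (hl : μ l + 1 = μ k)
    (hj : ¬∃ i, β i + 1 = β j) (z : ℝ) : correctionTerm μ β q k j z = μ l • q l j z := by
  have hk : ∃ l, μ l + 1 = μ k := ⟨l, hl⟩
  have hc : hk.choose = l := hμ.injective (by linarith [hk.choose_spec])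
  rw [correctionTerm, dif_pos hk, dif_neg hj, hc, add_zero]

theorem correctionTerm_of_add_one_of_add_one (hμ : StrictMono μ) (hβ : StrictMono β) {l i : ℕ}
    (hl : μ l + 1 = μ k) (hi : β i + 1 = β j) (z : ℝ) :
    correctionTerm μ β q k j z = μ l • q l j z + (β i • q l i z - deriv (q l i) z) := by
  have hk : ∃ l, μ l + 1 = μ k := ⟨l, hl⟩
  have hj : ∃ i, β i + 1 = β j := ⟨i, hi⟩
  have hc : hk.choose = l := hμ.injective (by linarith [hk.choose_spec])
  have hd : hj.choose = i := hβ.injective (by linarith [hj.choose_spec])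
  rw [correctionTerm, dif_pos hk, dif_pos hj, hc, hd]

theorem correctionTerm_congr (hμ : StrictMono μ)
    {q' : ℕ → ℕ → ℝ → EuclideanSpace ℝ (Fin n)} (h : ∀ i < k, q i = q' i) (z : ℝ) :
    correctionTerm μ β q k j z = correctionTerm μ β q' k j z := by
  by_cases hk : ∃ l, μ l + 1 = μ k
  · rw [correctionTerm, correctionTerm, dif_pos hk, dif_pos hk,
      h _ (hμ.lt_iff_lt.1 (by linarith [hk.choose_spec]))]
  · rw [correctionTerm_eq_zero hk, correctionTerm_eq_zero hk]

theorem isVectorPolynomial_nonlinearTerm (hμ : StrictMono μ) (hμ0 : 0 < μ 0) (hβ : StrictMono β)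
    (hβ0 : 0 ≤ β 0) (hq : ∀ i < k, ∀ j, IsVectorPolynomial (q i j)) :
    IsVectorPolynomial (nonlinearTerm μ β 𝒢 q k j) := by
  have hfin := resonantTuples_finite hμ hμ0 hβ hβ0 k j
  have : nonlinearTerm μ β 𝒢 q k j = fun z =>
      ∑ s ∈ hfin.toFinset, 𝒢 s.1 fun i => q (s.2 i).1 (s.2 i).2 z :=
    funext fun z => finsum_mem_eq_finite_toFinset_sum _ hfin
  rw [this]
  exact IsVectorPolynomial.sum _ fun s hs => IsVectorPolynomial.multilinear _ fun i =>
    hq _ (fst_lt_of_mem_resonantTuples hμ hμ0 (hfin.mem_toFinset.1 hs) i) _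

theorem isVectorPolynomial_correctionTerm (hμ : StrictMono μ) (hβ : StrictMono β)
    (hq : ∀ i < k, ∀ j, IsVectorPolynomial (q i j)) :
    IsVectorPolynomial (correctionTerm μ β q k j) := by
  by_cases hk : ∃ l, μ l + 1 = μ k
  · obtain ⟨l, hl⟩ := hk
    have hlk : l < k := hμ.lt_iff_lt.1 (by linarith)
    by_cases hj : ∃ i, β i + 1 = β j
    · obtain ⟨i, hi⟩ := hj
      rw [funext (correctionTerm_of_add_one_of_add_one hμ hβ hl hi)]
      exact ((hq l hlk j).const_smul _).add (((hq l hlk i).const_smul _).sub (hq l hlk i).deriv)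
    · rw [funext (correctionTerm_of_add_one hμ hl hj)]
      exact (hq l hlk j).const_smul _
  · rw [funext (correctionTerm_eq_zero hk)]
    exact IsVectorPolynomial.zero

theorem finite_support_lt (hq : ∀ i < k, {j | q i j ≠ 0}.Finite) :
    {x : ℕ × ℕ | x.1 < k ∧ q x.1 x.2 ≠ 0}.Finite := by
  refine ((Finset.range k).finite_toSet.biUnion fun i hi =>
    (hq i (Finset.mem_range.1 hi)).image (Prod.mk i)).subset fun x hx => ?_
  simp only [Set.mem_iUnion]
  exact ⟨x.1, Finset.mem_coe.2 (Finset.mem_range.2 hx.1), x.2, hx.2, rfl⟩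

theorem finite_nonlinearTerm_ne_zero (hμ : StrictMono μ) (hμ0 : 0 < μ 0) (hβ : StrictMono β)
    (hq : ∀ i < k, {j | q i j ≠ 0}.Finite) : {j | nonlinearTerm μ β 𝒢 q k j ≠ 0}.Finite := by
  obtain ⟨M, hM⟩ := exists_nat_gt (μ k / μ 0)
  rw [div_lt_iff₀ hμ0] at hM
  set F := (finite_support_lt hq).toFinset
  set S := (Finset.Icc 2 M).sigma fun m => Fintype.piFinset fun _ : Fin m => F
  refine ((S.finite_toSet.image fun s => ∑ i, β (s.2 i).2).preimage hβ.injective.injOn).subset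
    fun j hj => ?_
  obtain ⟨z, hz⟩ := Function.ne_iff.1 hj
  obtain ⟨s, hs, hne⟩ := exists_ne_zero_of_finsum_mem_ne_zero hz
  exact ⟨s, mem_sigma_of_mem_resonantTuples hμ hμ0 (F := F)
    (fun x h h' => (Set.Finite.mem_toFinset _).2 ⟨h, h'⟩) hM hs hne, hs.2.2⟩

theorem finite_correctionTerm_ne_zero (hμ : StrictMono μ) (hβ : StrictMono β)
    (hq : ∀ i < k, {j | q i j ≠ 0}.Finite) : {j | correctionTerm μ β q k j ≠ 0}.Finite := by
  by_cases hk : ∃ l, μ l + 1 = μ k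
  · obtain ⟨l, hl⟩ := hk
    have hfin := hq l (hμ.lt_iff_lt.1 (by linarith))
    refine (hfin.union ((hfin.image fun i => β i + 1).preimage hβ.injective.injOn)).subset
      fun j hj => ?_
    by_contra hcon
    obtain ⟨h1, h2⟩ : q l j = 0 ∧ ∀ i, q l i ≠ 0 → β i + 1 ≠ β j := by
      simpa [not_or] using hcon
    refine hj (funext fun z => ?_)
    by_cases hi : ∃ i, β i + 1 = β j
    · obtain ⟨i, hi⟩ := hi
      have h3 : q l i = 0 := by_contra fun h => h2 i h hi
      rw [correctionTerm_of_add_one_of_add_one hμ hβ hl hi, h1, h3]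
      simp
    · rw [correctionTerm_of_add_one hμ hl hi, h1]
      simp
  · refine Set.finite_empty.subset fun j hj => hj (funext fun z => correctionTerm_eq_zero hk z)

theorem exists_expansion_coefficients (hμ : StrictMono μ) (hμ0 : 0 < μ 0) (hβ : StrictMono β)
    (hβ0 : 0 ≤ β 0) (T : EuclideanSpace ℝ (Fin n) →ₗ[ℝ] EuclideanSpace ℝ (Fin n))
    (𝒢 : (m : ℕ) → MultilinearMap ℝ (fun _ : Fin m => EuclideanSpace ℝ (Fin n))
      (EuclideanSpace ℝ (Fin n)))
    {p : ℕ → ℕ → ℝ → EuclideanSpace ℝ (Fin n)} (hp : ∀ k j, IsVectorPolynomial (p k j))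
    (hpfin : ∀ k, {j | p k j ≠ 0}.Finite) :
    ∃ q : ℕ → ℕ → ℝ → EuclideanSpace ℝ (Fin n),
      (∀ k j, IsVectorPolynomial (q k j)) ∧ (∀ k, {j | q k j ≠ 0}.Finite) ∧
      ∀ k j z, q k j z =
        T (nonlinearTerm μ β 𝒢 q k j z + p k j z + correctionTerm μ β q k j z) := by
  obtain ⟨q, hq⟩ := exists_eq_of_causal
    (fun (q : ℕ → ℕ → ℝ → EuclideanSpace ℝ (Fin n)) k j z =>
      T (nonlinearTerm μ β 𝒢 q k j z + p k j z + correctionTerm μ β q k j z))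
    fun q q' k h => by
      funext j z
      rw [nonlinearTerm_congr hμ hμ0 h, correctionTerm_congr hμ h]
  have hq' : ∀ k j, q k j = fun z =>
      T (nonlinearTerm μ β 𝒢 q k j z + p k j z + correctionTerm μ β q k j z) :=
    fun k j => congrFun (hq k) j
  refine ⟨q, fun k => ?_, fun k => ?_, fun k j z => congrFun (hq' k j) z⟩
  · induction k using Nat.strong_induction_on with
    | _ k ih =>
      intro j
      rw [hq' k j]
      exact (((isVectorPolynomial_nonlinearTerm hμ hμ0 hβ hβ0 ih).add (hp k j)).add
        (isVectorPolynomial_correctionTerm hμ hβ ih)).map T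
  · induction k using Nat.strong_induction_on with
    | _ k ih =>
      refine (((finite_nonlinearTerm_ne_zero (𝒢 := 𝒢) hμ hμ0 hβ ih).union (hpfin k)).union
        (finite_correctionTerm_ne_zero hμ hβ ih)).subset fun j hj => ?_
      by_contra hcon
      obtain ⟨⟨h1, h2⟩, h3⟩ : (nonlinearTerm μ β 𝒢 q k j = 0 ∧ p k j = 0) ∧
          correctionTerm μ β q k j = 0 := by
        simpa [not_or] using hcon
      refine hj ?_
      rw [hq' k j, h1, h2, h3]
      funext z
      simp

end

/-! ### The truncated series as an approximate solution -/

section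

variable {n : ℕ} {μ β : ℕ → ℝ} {N : ℕ} {q : ℕ → ℕ → ℝ → EuclideanSpace ℝ (Fin n)}
  {F : Finset (ℕ × ℕ)}

/-- `∑ t^{-μ_k} (ln t)^{-β_j} q_{k,j}(ln ln t)` over the pairs `(k, j)` in `F` -/
noncomputable def partialExpansion {n : ℕ} (μ β : ℕ → ℝ)
    (q : ℕ → ℕ → ℝ → EuclideanSpace ℝ (Fin n)) (F : Finset (ℕ × ℕ)) (t : ℝ) :
    EuclideanSpace ℝ (Fin n) :=
  ∑ x ∈ F, powLogTerm (μ x.1) (β x.2) (q x.1 x.2) t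

theorem hasExpansionUpTo_map_partialExpansion (hμ : StrictMono μ) (hβ0 : ∀ j, 0 ≤ β j)
    (hq : ∀ k j, IsVectorPolynomial (q k j)) (hF : ∀ x, x ∈ F ↔ x.1 ≤ N ∧ q x.1 x.2 ≠ 0)
    (T : EuclideanSpace ℝ (Fin n) →ₗ[ℝ] EuclideanSpace ℝ (Fin n)) :
    HasExpansionUpTo μ β N (fun t => T (partialExpansion μ β q F t))
      (fun k j z => T (q k j z)) := by
  refine (HasExpansionUpTo.sum_powLogTerm hμ hβ0 F Prod.fst Prod.snd
    (p := fun x z => T (q x.1 x.2 z)) fun x _ => (hq _ _).map T).congr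
    (Eventually.of_forall fun t => by simp [partialExpansion, powLogTerm]) fun k hk j z => ?_
  refine Finset.sum_filter_eq_of_unique F _ _ (k, j) (fun x => by rw [Prod.ext_iff]) fun hx => ?_
  have h0 : q k j = 0 := by_contra fun h => hx ((hF _).2 ⟨hk, h⟩)
  simp [h0]

theorem hasExpansionUpTo_multilinear_partialExpansion (hμ : StrictMono μ) (hμ0 : 0 < μ 0)
    (hβ : StrictMono β) (hβ0 : ∀ j, 0 ≤ β j)
    (hμadd : PreservesAddition (Set.range μ)) (hβadd : PreservesAddition (Set.range β))
    (hq : ∀ k j, IsVectorPolynomial (q k j)) (hF : ∀ x, x ∈ F ↔ x.1 ≤ N ∧ q x.1 x.2 ≠ 0)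
    (𝒢 : (m : ℕ) → MultilinearMap ℝ (fun _ : Fin m => EuclideanSpace ℝ (Fin n))
      (EuclideanSpace ℝ (Fin n))) {M : ℕ} (hM : μ N < M * μ 0) :
    HasExpansionUpTo μ β N
      (fun t => ∑ m ∈ Finset.Icc 2 M, 𝒢 m fun _ => partialExpansion μ β q F t)
      (nonlinearTerm μ β 𝒢 q) := by
  have hex : ∀ s : Σ m : ℕ, Fin m → ℕ × ℕ, ∃ k j, 0 < s.1 →
      μ k = ∑ i, μ (s.2 i).1 ∧ β j = ∑ i, β (s.2 i).2 := fun s => by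
    by_cases hs : 0 < s.1
    · obtain ⟨k, hk⟩ := hμadd.exists_eq_sum hs fun i => (s.2 i).1
      obtain ⟨j, hj⟩ := hβadd.exists_eq_sum hs fun i => (s.2 i).2
      exact ⟨k, j, fun _ => ⟨hk, hj⟩⟩
    -- Dummy labels: the empty sum need not be a value of `μ`, and empty tuples never occur in `S`.
    · exact ⟨0, 0, fun h => absurd h hs⟩
  choose κ l hκl using hex
  set S := (Finset.Icc 2 M).sigma fun m => Fintype.piFinset fun _ : Fin m => F with hS
  have hSpos : ∀ s ∈ S, 2 ≤ s.1 := fun s hs => by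
    rw [hS, Finset.mem_sigma, Finset.mem_Icc] at hs
    exact hs.1.1
  refine (HasExpansionUpTo.sum_powLogTerm hμ hβ0 S κ l
    (p := fun s z => 𝒢 s.1 fun i => q (s.2 i).1 (s.2 i).2 z) fun s _ =>
      IsVectorPolynomial.multilinear _ fun i => hq _ _).congr ?_ fun k hk j z => ?_
  · filter_upwards [eventually_gt_atTop 1] with t ht
    have h0 : 0 < t := by linarith
    have hL : 0 < Real.log t := Real.log_pos ht
    rw [hS, Finset.sum_sigma]
    refine Finset.sum_congr rfl fun m hm => ?_
    simp only [partialExpansion]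
    rw [MultilinearMap.map_sum_finset]
    refine Finset.sum_congr rfl fun u _ => ?_
    obtain ⟨h1, h2⟩ := hκl ⟨m, u⟩ (by have := (Finset.mem_Icc.1 hm).1; simp only; omega)
    simp only [powLogTerm, h1, h2]
    rw [MultilinearMap.map_smul_univ (𝒢 m) (fun i => t ^ (-μ (u i).1)),
      MultilinearMap.map_smul_univ (𝒢 m) (fun i => Real.log t ^ (-β (u i).2)),
      ← Finset.sum_neg_distrib, ← Finset.sum_neg_distrib, Real.rpow_sum_of_pos h0,
      Real.rpow_sum_of_pos hL]
  -- For `k ≤ N` the fibre of `S` over `(k, j)` is the set of resonant tuples, up to tuples with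
  -- vanishing contribution.
  · symm
    refine finsum_mem_eq_sum_of_inter_support_eq _ (Set.ext fun s => ?_)
    simp only [Set.mem_inter_iff, Finset.mem_coe, Finset.mem_filter, Function.mem_support]
    refine and_congr_left fun hne => ⟨fun hs => ?_, fun ⟨hs, h1, h2⟩ => ?_⟩
    · obtain ⟨h1, h2⟩ := hκl s (by have := hs.1; omega)
      exact ⟨mem_sigma_of_mem_resonantTuples hμ hμ0
        (fun x hx hx' => (hF x).2 ⟨hx.le.trans hk, hx'⟩)
        ((hμ.monotone hk).trans_lt hM) hs hne, hμ.injective (h1.trans hs.2.1),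
        hβ.injective (h2.trans hs.2.2)⟩
    · obtain ⟨h3, h4⟩ := hκl s (by have := hSpos s hs; omega)
      exact ⟨hSpos s hs, by rw [← h3, h1], by rw [← h4, h2]⟩

/-- The function `d` is minus the derivative, matching the sign of `correctionTerm`. The index
shifts are injective, so each coefficient receives at most one term of each kind. -/
theorem exists_hasDerivAt_partialExpansion (hμ : StrictMono μ)
    (hβ : StrictMono β) (hβ0 : ∀ j, 0 ≤ β j)
    (hμone : PreservesUnitIncrement (Set.range μ)) (hβone : PreservesUnitIncrement (Set.range β))
    (hq : ∀ k j, IsVectorPolynomial (q k j)) (hF : ∀ x, x ∈ F ↔ x.1 ≤ N ∧ q x.1 x.2 ≠ 0) :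
    ∃ d : ℝ → EuclideanSpace ℝ (Fin n),
      (∀ t, 1 < t → HasDerivAt (partialExpansion μ β q F) (-d t) t) ∧
      HasExpansionUpTo μ β N d (correctionTerm μ β q) := by
  choose κ hκ using fun k => hμone _ ⟨k, rfl⟩
  choose l hl using fun j => hβone _ ⟨j, rfl⟩
  have hκinj : ∀ k k', κ k = κ k' ↔ k = k' := fun k k' =>
    ⟨fun h => hμ.injective (by linarith [hκ k, hκ k', congrArg μ h]), congrArg κ⟩
  have hlinj : ∀ j j', l j = l j' ↔ j = j' := fun j j' =>
    ⟨fun h => hβ.injective (by linarith [hl j, hl j', congrArg β h]), congrArg l⟩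
  refine ⟨_, fun t ht => ?_, ((HasExpansionUpTo.sum_powLogTerm hμ hβ0 F (fun x => κ x.1) Prod.snd
    (p := fun x z => μ x.1 • q x.1 x.2 z) fun x _ => (hq _ _).const_smul _).add
    (HasExpansionUpTo.sum_powLogTerm hμ hβ0 F (fun x => κ x.1) (fun x => l x.2)
    (p := fun x z => β x.2 • q x.1 x.2 z - deriv (q x.1 x.2) z) fun x _ =>
      ((hq _ _).const_smul _).sub (hq _ _).deriv)).congr
    (Eventually.of_forall fun _ => rfl) fun k hk j z => ?_⟩
  · refine (HasDerivAt.fun_sum fun x _ => hasDerivAt_powLogTerm (hq _ _) _ _ ht).congr_deriv ?_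
    simp only [Finset.sum_neg_distrib, Finset.sum_add_distrib, hκ, hl]
  · simp only [Pi.add_apply]
    by_cases hk' : ∃ k', μ k' + 1 = μ k
    · obtain ⟨k', hk'⟩ := hk'
      obtain rfl : κ k' = k := hμ.injective ((hκ k').trans hk')
      -- The shift raises the index, so truncation at `N` discards no term contributing to a
      -- coefficient with `k ≤ N`.
      have hk'N : k' ≤ N := (hμ.lt_iff_lt.1 (by linarith : μ k' < μ (κ k'))).le.trans hk
      have hq0 : ∀ i, (k', i) ∉ F → q k' i = 0 := fun i h =>
        by_contra fun h' => h ((hF _).2 ⟨hk'N, h'⟩)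
      have h1 : ∑ x ∈ F with κ x.1 = κ k' ∧ x.2 = j, μ x.1 • q x.1 x.2 z =
          μ k' • q k' j z :=
        Finset.sum_filter_eq_of_unique F _ (fun x => μ x.1 • q x.1 x.2 z) (k', j)
          (fun x => by rw [hκinj, Prod.ext_iff]) fun h => by simp [hq0 _ h]
      rw [h1]
      by_cases hj' : ∃ i, β i + 1 = β j
      · obtain ⟨i, hi⟩ := hj'
        obtain rfl : l i = j := hβ.injective ((hl i).trans hi)
        rw [correctionTerm_of_add_one_of_add_one hμ hβ hk' hi]
        congr 1
        exact Finset.sum_filter_eq_of_unique F _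
          (fun x => β x.2 • q x.1 x.2 z - deriv (q x.1 x.2) z) (k', i)
          (fun x => by rw [hκinj, hlinj, Prod.ext_iff]) fun h => by simp [hq0 _ h]
      · rw [correctionTerm_of_add_one hμ hk' hj', Finset.filter_false_of_mem, Finset.sum_empty,
          add_zero]
        exact fun x _ h => hj' ⟨x.2, by rw [← hl, h.2]⟩
    · rw [correctionTerm_eq_zero hk', Finset.filter_false_of_mem, Finset.filter_false_of_mem,
        Finset.sum_empty, Finset.sum_empty, add_zero]
      · exact fun x _ h => hk' ⟨x.1, by rw [← hκ, h.1]⟩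
      · exact fun x _ h => hk' ⟨x.1, by rw [← hκ, h.1]⟩

theorem partialExpansion_isBigO (hμ : StrictMono μ) (hβ0 : ∀ j, 0 ≤ β j)
    (hq : ∀ k j, IsVectorPolynomial (q k j)) {a : ℝ} (ha : a < μ 0) :
    partialExpansion μ β q F =O[atTop] fun t : ℝ => t ^ (-a) :=
  IsBigO.fun_sum fun x _ => powLogTerm_isBigO (hq _ _) (hβ0 _)
    (ha.trans_le (hμ.monotone (Nat.zero_le x.1)))

theorem HasPowerLogLogExpansion.isBigO (hβ0 : ∀ j, 0 ≤ β j)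
    {f : ℝ → EuclideanSpace ℝ (Fin n)} {p : ℕ → ℕ → ℝ → EuclideanSpace ℝ (Fin n)}
    (hp : ∀ k j, IsVectorPolynomial (p k j)) (hpfin : ∀ k, {j | p k j ≠ 0}.Finite)
    (h : HasPowerLogLogExpansion f μ β p) {a : ℝ} (ha : a < μ 0) :
    f =O[atTop] fun t : ℝ => t ^ (-a) := by
  obtain ⟨ν, hν, hO⟩ := h 0
  have h1 : (fun t : ℝ => t ^ (-μ 0) • logCoefficient β p 0 t) =O[atTop]
      fun t : ℝ => t ^ (-a) := by
    simp only [logCoefficient_eq_sum (hpfin 0).coe_toFinset.superset, Finset.smul_sum]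
    exact IsBigO.fun_sum fun j _ => powLogTerm_isBigO (hp 0 j) (hβ0 j) ha
  refine ((hO.trans (isBigO_rpow_neg_mono (by linarith : a ≤ ν))).add h1).congr_left fun t => ?_
  simp

end

/-! ### Comparison of the solution with the truncated series -/

theorem IsDiagonalizablePos.isUnit_det {n : ℕ} {A : Matrix (Fin n) (Fin n) ℝ}
    (hA : IsDiagonalizablePos A) : IsUnit A.det := by
  obtain ⟨S, Λ, hS, hΛ, rfl⟩ := hA
  have h := ((Matrix.isUnit_iff_isUnit_det S).1 hS).ne_zero
  rw [isUnit_iff_ne_zero, Matrix.det_mul, Matrix.det_mul, Matrix.det_nonsing_inv,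
    Ring.inverse_eq_inv', Matrix.det_diagonal]
  exact mul_ne_zero (mul_ne_zero (inv_ne_zero h)
    (Finset.prod_ne_zero_iff.2 fun i _ => (hΛ i).ne')) h

theorem norm_rpow_isLittleO {E : Type*} [NormedAddCommGroup E] {s : ℝ} (hs : 1 < s) :
    (fun v : E => ‖v‖ ^ s) =o[𝓝 0] fun v : E => v := by
  have h1 : Tendsto (fun v : E => ‖v‖ ^ (s - 1)) (𝓝 0) (𝓝 0) := by
    have h := (tendsto_norm_zero (E := E)).rpow_const (p := s - 1) (Or.inr (by linarith))
    rwa [Real.zero_rpow (by linarith)] at h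
  refine (((isBigO_refl (fun v : E => ‖v‖) (𝓝 0)).mul_isLittleO
    ((isLittleO_one_iff ℝ).2 h1)).congr (fun v => ?_) fun v => mul_one _).of_norm_right
  rw [← Real.rpow_one_add' (norm_nonneg v) (by linarith), add_sub_cancel]

section

variable {n : ℕ} {𝒢 : (m : ℕ) → MultilinearMap ℝ (fun _ : Fin m => EuclideanSpace ℝ (Fin n))
    (EuclideanSpace ℝ (Fin n))} {M : ℕ}

theorem sum_diag_sub_sum_diag_isLittleO {ι : Type*} {l : Filter ι}
    {u v : ι → EuclideanSpace ℝ (Fin n)} (hu : Tendsto u l (𝓝 0)) (hv : Tendsto v l (𝓝 0)) :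
    (fun t => ∑ m ∈ Finset.Icc 2 M, 𝒢 m (fun _ => u t) -
      ∑ m ∈ Finset.Icc 2 M, 𝒢 m fun _ => v t) =o[l] fun t => u t - v t := by
  simp only [← Finset.sum_sub_distrib]
  exact IsLittleO.fun_sum fun m hm =>
    (𝒢 m).diag_sub_diag_isLittleO (Finset.mem_Icc.1 hm).1 hu hv

theorem isLittleO_of_sub_sum_diag_isBigO
    {G : EuclideanSpace ℝ (Fin n) → EuclideanSpace ℝ (Fin n)} {s : ℝ} (hs : 1 < s)
    (hG : (fun v => G v - ∑ m ∈ Finset.Icc 2 M, 𝒢 m fun _ => v) =O[𝓝 0] fun v => ‖v‖ ^ s) :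
    G =o[𝓝 0] fun v => v := by
  have h := sum_diag_sub_sum_diag_isLittleO (𝒢 := 𝒢) (M := M)
    (tendsto_id (x := 𝓝 (0 : EuclideanSpace ℝ (Fin n)))) tendsto_const_nhds
  have h0 : ∑ m ∈ Finset.Icc 2 M, 𝒢 m (fun _ => 0) = 0 :=
    Finset.sum_eq_zero fun m hm =>
      (𝒢 m).map_coord_zero ⟨0, by have := (Finset.mem_Icc.1 hm).1; omega⟩ rfl
  simp only [h0, sub_zero, id] at h
  exact ((hG.trans_isLittleO (norm_rpow_isLittleO hs)).add h).congr_left fun v => by simp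

end

theorem mainTheorem7 (n : ℕ)
    (A : Matrix (Fin n) (Fin n) ℝ) (hA : IsDiagonalizablePos A)
    (G : EuclideanSpace ℝ (Fin n) → EuclideanSpace ℝ (Fin n)) (hG : LocallyLipschitz G)
    (Gm : ℕ → EuclideanSpace ℝ (Fin n) → EuclideanSpace ℝ (Fin n))
    (hGm : ∀ m, 2 ≤ m → IsHomogeneousPolynomialMap m (Gm m))
    (hGexp : HasHomogeneousExpansion G Gm)
    (f : ℝ → EuclideanSpace ℝ (Fin n))
    (hf : ∃ Tf : ℝ, 0 ≤ Tf ∧ ContinuousOn f (Set.Ici Tf))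
    (y : ℝ → EuclideanSpace ℝ (Fin n))
    (hy : ∃ T₀ : ℝ, 0 ≤ T₀ ∧ ContDiffOn ℝ 1 y (Set.Ioi T₀) ∧
      ∀ t, T₀ < t → HasDerivAt y (-(Matrix.toEuclideanLin A (y t)) + G (y t) + f t) t)
    (hy0 : Tendsto y atTop (𝓝 0))
    (μ β : ℕ → ℝ)
    (hμ : StrictMono μ) (hμdiv : Tendsto μ atTop atTop) (hμ0 : 0 < μ 0)
    (hμadd : PreservesAddition (Set.range μ)) (hμone : PreservesUnitIncrement (Set.range μ))
    (hβ : StrictMono β) (hβdiv : Tendsto β atTop atTop) (hβ0 : 0 ≤ β 0)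
    (hβadd : PreservesAddition (Set.range β)) (hβone : PreservesUnitIncrement (Set.range β))
    (p : ℕ → ℕ → ℝ → EuclideanSpace ℝ (Fin n))
    (hp : ∀ k j, IsVectorPolynomial (p k j))
    (hpfin : ∀ k, {j | p k j ≠ 0}.Finite)
    (hfexp : HasPowerLogLogExpansion f μ β p) :
    (∀ m, 2 ≤ m → ∃ M : MultilinearMap ℝ (fun _ : Fin m => EuclideanSpace ℝ (Fin n))
        (EuclideanSpace ℝ (Fin n)), ∀ v, M (fun _ => v) = Gm m v) ∧
    ∀ 𝒢 : (m : ℕ) → MultilinearMap ℝ (fun _ : Fin m => EuclideanSpace ℝ (Fin n))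
        (EuclideanSpace ℝ (Fin n)),
      (∀ m, 2 ≤ m → ∀ v, 𝒢 m (fun _ => v) = Gm m v) →
      ∃ q : ℕ → ℕ → ℝ → EuclideanSpace ℝ (Fin n),
        (∀ k j, IsVectorPolynomial (q k j)) ∧
        (∀ k, {j | q k j ≠ 0}.Finite) ∧
        (∀ j z, q 0 j z = Matrix.toEuclideanLin A⁻¹ (p 0 j z)) ∧
        (∀ k, 1 ≤ k → ∀ j z, q k j z = Matrix.toEuclideanLin A⁻¹
          (nonlinearTerm μ β 𝒢 q k j z + p k j z + correctionTerm μ β q k j z)) ∧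
        HasPowerLogLogExpansion y μ β q := by

  refine ⟨fun m hm => (hGm m hm).exists_multilinearMap, fun 𝒢 h𝒢 => ?_⟩
  have hβ0' : ∀ j, 0 ≤ β j := fun j => hβ0.trans (hβ.monotone (Nat.zero_le j))
  obtain ⟨q, hq, hqfin, hrec⟩ := exists_expansion_coefficients hμ hμ0 hβ hβ0
    (Matrix.toEuclideanLin A⁻¹) 𝒢 hp hpfin
  have hAA : ∀ v, Matrix.toEuclideanLin A (Matrix.toEuclideanLin A⁻¹ v) = v := fun v => by
    simp [Matrix.toLpLin_apply, Matrix.mulVec_mulVec, Matrix.mul_nonsing_inv A hA.isUnit_det]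
  refine ⟨q, hq, hqfin, fun j z => ?_, fun k _ => hrec k, fun N => ?_⟩
  · have h1 : nonlinearTerm μ β 𝒢 q 0 j z = 0 := by
      refine finsum_mem_eq_zero_of_forall_eq_zero fun s hs => ?_
      exact absurd (fst_lt_of_mem_resonantTuples hμ hμ0 hs ⟨0, by have := hs.1; omega⟩)
        (Nat.not_lt_zero _)
    have h2 : ¬∃ l, μ l + 1 = μ 0 := fun ⟨l, hl⟩ => by
      linarith [hμ.monotone (Nat.zero_le l)]
    rw [hrec, h1, correctionTerm_eq_zero h2, zero_add, add_zero]
  obtain ⟨T₀, -, -, hy⟩ := hy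
  obtain ⟨M₀, hM₀⟩ := exists_nat_gt (μ N / (μ 0 / 2))
  -- Only `y = O(t^(-μ 0 / 2))` will be available, so the Taylor degree `M` must satisfy this bound
  -- for the remainder of `G` to decay faster than `t^(-μ N)`.
  obtain ⟨M, hM2, hM⟩ : ∃ M : ℕ, 2 ≤ M ∧ μ N < M * (μ 0 / 2) := by
    refine ⟨max 2 M₀, le_max_left _ _, ?_⟩
    rw [← div_lt_iff₀ (by linarith)]
    exact hM₀.trans_le (by exact_mod_cast le_max_right _ _)
  have hM' : μ N < M * μ 0 := hM.trans_le (by gcongr; linarith)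
  obtain ⟨δ, hδ, hGM⟩ := hGexp M hM2
  have hP : ∀ v, ∑ m ∈ Finset.Icc 2 M, Gm m v = ∑ m ∈ Finset.Icc 2 M, 𝒢 m fun _ => v :=
    fun v => Finset.sum_congr rfl fun m hm => (h𝒢 m (Finset.mem_Icc.1 hm).1 v).symm
  simp only [hP] at hGM
  have hM2' : (2 : ℝ) ≤ M := by exact_mod_cast hM2
  have hGo := isLittleO_of_sub_sum_diag_isBigO (by linarith) hGM
  have hyO : y =O[atTop] fun t : ℝ => t ^ (-(μ 0 / 2)) := by
    refine isBigO_rpow_of_hasDerivAt_diagonalizable hA (h₁ := fun t => G (y t)) (h₂ := f) ?_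
      (hGo.comp_tendsto hy0) (hfexp.isBigO hβ0' hp hpfin (by linarith))
    filter_upwards [eventually_gt_atTop T₀] with t ht using hy t ht
  have hfinF := finite_support_lt (k := N + 1) fun i _ => hqfin i
  set F := hfinF.toFinset
  have hF : ∀ x, x ∈ F ↔ x.1 ≤ N ∧ q x.1 x.2 ≠ 0 := fun x => by
    simp [F]
  obtain ⟨d, hd, hdexp⟩ := exists_hasDerivAt_partialExpansion hμ hβ hβ0' hμone hβone hq hF
  set Y := partialExpansion μ β q F
  have hY0 : Tendsto Y atTop (𝓝 0) :=
    (partialExpansion_isBigO hμ hβ0' hq (by linarith : μ 0 / 2 < μ 0)).trans_tendsto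
      (tendsto_rpow_neg_atTop (by linarith))
  have hfN : HasExpansionUpTo μ β N f p := ⟨fun k _ => hpfin k, hfexp N⟩
  -- The residual of `Y`: applying `A` to the recursion shows that all its coefficients up to `N`
  -- vanish.
  have hres := ((((hasExpansionUpTo_multilinear_partialExpansion hμ hμ0 hβ hβ0' hμadd hβadd hq hF
    𝒢 hM').add hfN).add hdexp).add (hasExpansionUpTo_map_partialExpansion hμ hβ0' hq hF
    (-Matrix.toEuclideanLin A))).congr (c' := 0) (Eventually.of_forall fun _ => rfl)
    fun k _ j z => by
      have h := congrArg (Matrix.toEuclideanLin A) (hrec k j z)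
      rw [hAA] at h
      simp [h]
  have hG : HasExpansionUpTo μ β N
      (fun t => G (y t) - ∑ m ∈ Finset.Icc 2 M, 𝒢 m fun _ => y t) 0 := by
    refine HasExpansionUpTo.of_isBigO (ν := μ 0 / 2 * (M + δ)) (by nlinarith)
      ((hGM.comp_tendsto hy0).trans ?_)
    refine (hyO.norm_left.rpow (r := M + δ) (by linarith) ?_).congr' .rfl ?_
    · filter_upwards [eventually_gt_atTop 0] with t ht
      exact Real.rpow_nonneg ht.le _
    · filter_upwards [eventually_gt_atTop 0] with t ht
      rw [← Real.rpow_mul ht.le, neg_mul]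
  obtain ⟨ν, hν, hO⟩ := ((hG.add hres).congr (c' := 0) (Eventually.of_forall fun _ => rfl)
    (by simp)).isBigO
  have hyY : (fun t => y t - Y t) =O[atTop] fun t : ℝ => t ^ (-ν) := by
    refine isBigO_rpow_of_hasDerivAt_diagonalizable hA ?_
      (sum_diag_sub_sum_diag_isLittleO (𝒢 := 𝒢) (M := M) hy0 hY0) hO
    filter_upwards [eventually_gt_atTop T₀, eventually_gt_atTop 1] with t ht ht1
    refine ((hy t ht).sub (hd t ht1)).congr_deriv ?_
    rw [map_sub, LinearMap.neg_apply]
    abel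
  exact (((HasExpansionUpTo.of_isBigO hν hyY).add
    (hasExpansionUpTo_map_partialExpansion hμ hβ0' hq hF LinearMap.id)).congr (c' := q)
    (Eventually.of_forall fun t => sub_add_cancel (y t) (Y t)) (by simp)).2
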